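/- For complex numbers $a, q$ with $|q|<1$ and an integer $n \ge 0$, write $(a;q)_n = \prod_{k=0}^{n-1}(1-aq^k)$ and $(a;q)_\infty = \prod_{k=0}^{\infty}(1-aq^k)$. Let $q$ be a complex number with $|q|<1$. Then all the series below converge absolutely, and (i) $$\sum_{n=1}^{\infty}\frac{q^n}{1-q^n}\,(-q^{n+1};q)_\infty=(-q;q)_\infty\left(\frac12+\sum_{n=1}^{\infty}\frac{q^n}{1+q^n}\right)-\frac12\sum_{n=0}^{\infty}\frac{q^{n(n+1)/2}}{(-q;q)_n};$$ (ii) $$\sum_{n=1}^{\infty}\frac{q^{2n}}{1-q^{2n}}\,(-q^{2n+1};q^2)_\infty=(-q;q^2)_\infty\sum_{n=1}^{\infty}\frac{q^{2n-1}}{1+q^{2n-1}}-\sum_{n=1}^{\infty}\frac{q^{n^2}}{(-q;q^2)_n}.$$ (Convention: $0^0=1$ when $q=0$.) -/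

import Mathlib

/-- The finite `q`-Pochhammer symbol `(a; q)_n = ∏_{k=0}^{n-1} (1 - a q^k)`. -/
noncomputable def qPoch (a q : ℂ) (n : ℕ) : ℂ :=
  ∏ k ∈ Finset.range n, (1 - a * q ^ k)

/-- The infinite `q`-Pochhammer symbol `(a; q)_∞ = ∏_{k=0}^∞ (1 - a q^k)`
(used for `‖q‖ < 1`, where the product converges unconditionally). -/
noncomputable def qPochInf (a q : ℂ) : ℂ :=
  ∏' k : ℕ, (1 - a * q ^ k)

theorem multipliable_qPochInf (a : ℂ) {q : ℂ} (hq : ‖q‖ < 1) :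
    Multipliable (fun k : ℕ => 1 - a * q ^ k) := by
  have h : Summable (fun k : ℕ => ‖-(a * q ^ k)‖) := by
    simp only [norm_neg, norm_mul, norm_pow]
    exact (summable_geometric_of_lt_one (norm_nonneg q) hq).mul_left _
  simpa [sub_eq_add_neg] using multipliable_one_add_of_summable h

/-- For `‖q‖ < 1`, the infinite symbol is the limit of the finite ones. -/
theorem tendsto_qPoch (a : ℂ) {q : ℂ} (hq : ‖q‖ < 1) :
    Filter.Tendsto (qPoch a q) Filter.atTop (nhds (qPochInf a q)) :=
  (multipliable_qPochInf a hq).hasProd.tendsto_prod_nat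

/-! The engine is the function `f(z) = ∑_{n ≥ 1} Q^n / (1 - Q^n) * (z Q^n; Q)_∞` (`lambertPoch`).
Telescoping gives it the first-order difference equation
`f(z) = (1 - z) f(z Q) + 1 - (z Q; Q)_∞` (`lambertPoch_eq`). Solved for `f(z Q)` in terms of `f(z)`
and applied along `z = t Q^{-1}, t Q^{-2}, …`, it yields, with
`(t; Q)_{-n} = ∏_{j=1}^n (1 - t Q^{-j})⁻¹`,

`f(t) = (t; Q)_{-m} f(t Q^{-m}) + (t; Q)_∞ ∑_{n=1}^m 1 / (1 - t Q^{-n}) - ∑_{n=1}^m (t; Q)_{-n}`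

(`lambertPoch_eq_iterate`). The remainder `(t; Q)_{-m} f(t Q^{-m})` tends to `0` by dominated
convergence (`tendsto_prod_mul_lambertPoch`), so `m → ∞` gives a closed formula for `f(t)`
(`lambertPoch_eq_tsum`).

At `t = -1`, `Q = q` one has `1 / (1 - t Q^{-n}) = q^n / (1 + q^n)` and
`(t; Q)_{-n} = q^{n(n+1)/2} / (-q; q)_n`; one more use of the difference equation, which passes from
`f(-1)` to `f(-q)`, gives (i). At `t = -q`, `Q = q²` these quantities are
`q^{2n-1} / (1 + q^{2n-1})` and `q^{n²} / (-q; q²)_n`, and the formula is (ii). Negative powers of `Q`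
exclude `q = 0`, where both identities are immediate. -/

open Filter Topology Finset

/-! ### The infinite `q`-Pochhammer symbol -/

theorem norm_qPochInf_sub_one_le (a : ℂ) {q : ℂ} (hq : ‖q‖ < 1) :
    ‖qPochInf a q - 1‖ ≤ Real.exp (‖a‖ * (1 - ‖q‖)⁻¹) - 1 := by
  refine le_of_tendsto ((tendsto_qPoch a hq).sub_const 1).norm (Eventually.of_forall fun n => ?_)
  have h := Finset.norm_prod_one_add_sub_one_le (range n) (fun k => -(a * q ^ k))
  simp only [← sub_eq_add_neg, norm_neg, norm_mul, norm_pow, ← mul_sum] at h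
  refine h.trans ?_
  gcongr
  rw [← tsum_geometric_of_lt_one (norm_nonneg q) hq]
  exact (summable_geometric_of_lt_one (norm_nonneg q) hq).sum_le_tsum _ fun i _ => by positivity

theorem norm_qPochInf_le (a : ℂ) {q : ℂ} (hq : ‖q‖ < 1) :
    ‖qPochInf a q‖ ≤ Real.exp (‖a‖ * (1 - ‖q‖)⁻¹) := by
  have h := norm_qPochInf_sub_one_le a hq
  have h' := norm_add_le (qPochInf a q - 1) 1
  rw [sub_add_cancel, norm_one] at h'
  linarith

/-- The symbols with arguments `z q^n`, for `n` varying, are uniformly bounded. -/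
theorem norm_qPochInf_mul_pow_le (z : ℂ) {q : ℂ} (hq : ‖q‖ < 1) (n : ℕ) :
    ‖qPochInf (z * q ^ n) q‖ ≤ Real.exp (‖z‖ * (1 - ‖q‖)⁻¹) := by
  refine (norm_qPochInf_le _ hq).trans (Real.exp_le_exp.2 ?_)
  have h1 : 0 ≤ (1 - ‖q‖)⁻¹ := inv_nonneg.2 (by linarith)
  refine mul_le_mul_of_nonneg_right ?_ h1
  rw [norm_mul, norm_pow]
  exact mul_le_of_le_one_right (norm_nonneg _) (pow_le_one₀ (norm_nonneg _) hq.le)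

theorem tendsto_qPochInf_mul_pow (z : ℂ) {q : ℂ} (hq : ‖q‖ < 1) :
    Tendsto (fun n : ℕ => qPochInf (z * q ^ n) q) atTop (𝓝 1) := by
  rw [tendsto_iff_norm_sub_tendsto_zero]
  refine squeeze_zero (fun _ => norm_nonneg _) (fun n => norm_qPochInf_sub_one_le _ hq) ?_
  have h0 : Tendsto (fun n : ℕ => z * q ^ n) atTop (𝓝 0) := by
    simpa using (tendsto_pow_atTop_nhds_zero_of_norm_lt_one hq).const_mul z
  have h : Tendsto (fun n : ℕ => Real.exp (‖z * q ^ n‖ * (1 - ‖q‖)⁻¹) - 1) atTop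
      (𝓝 (Real.exp (‖(0 : ℂ)‖ * (1 - ‖q‖)⁻¹) - 1)) :=
    ((Real.continuous_exp.tendsto _).comp (h0.norm.mul_const _)).sub_const 1
  simpa using h

theorem qPochInf_eq_one_sub_mul (z : ℂ) {q : ℂ} (hq : ‖q‖ < 1) :
    qPochInf z q = (1 - z) * qPochInf (z * q) q := by
  have e : ∀ k : ℕ, 1 - z * q ^ (k + 1) = 1 - z * q * q ^ k := fun k => by ring
  have h := tprod_eq_zero_mul' (f := fun k : ℕ => 1 - z * q ^ k)
    ((multipliable_qPochInf (z * q) hq).congr fun k => (e k).symm)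
  simp only [e, pow_zero, mul_one] at h
  exact h

/-! ### Summability -/

theorem summable_div_one_sub {x : ℕ → ℂ} (hx : Summable fun n => ‖x n‖) :
    Summable fun n => ‖x n / (1 - x n)‖ := by
  have h0 : Tendsto (fun n => ‖x n‖) atTop (𝓝 0) := hx.tendsto_atTop_zero
  refine Summable.of_norm_bounded_eventually_nat (hx.mul_left 2) ?_
  filter_upwards [h0.eventually_le_const (show (0 : ℝ) < 1 / 2 by norm_num)] with n hn
  have h1 : 1 / 2 ≤ ‖1 - x n‖ := by
    have := norm_sub_norm_le (1 : ℂ) (x n)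
    rw [norm_one] at this
    linarith
  rw [norm_norm, norm_div, div_le_iff₀ (by linarith)]
  nlinarith [norm_nonneg (x n)]

theorem summable_norm_pow_comp {q : ℂ} (hq : ‖q‖ < 1) {e : ℕ → ℕ} (he : Function.Injective e) :
    Summable fun n => ‖q ^ e n‖ := by
  simpa only [norm_pow, Function.comp_def] using
    (summable_geometric_of_lt_one (norm_nonneg q) hq).comp_injective he

theorem summable_pow_div_one_add {q : ℂ} (hq : ‖q‖ < 1) {e : ℕ → ℕ} (he : Function.Injective e) :
    Summable fun n => q ^ e n / (1 + q ^ e n) := by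
  have h := (summable_div_one_sub (x := fun n => -q ^ e n)
    (by simpa only [norm_neg] using summable_norm_pow_comp hq he)).of_norm
  simpa only [sub_neg_eq_add, neg_div, neg_neg] using h.neg

/-- Partial products of a null sequence are summable, by the ratio test. -/
theorem summable_prod_range_of_tendsto_zero {a : ℕ → ℂ} (ha : Tendsto a atTop (𝓝 0)) :
    Summable fun n => ∏ j ∈ range n, a j := by
  refine summable_of_ratio_norm_eventually_le (r := 1 / 2) (by norm_num) ?_
  have h0 : Tendsto (fun n => ‖a n‖) atTop (𝓝 0) := by simpa using ha.norm
  filter_upwards [h0.eventually_le_const (show (0 : ℝ) < 1 / 2 by norm_num)] with n hn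
  rw [prod_range_succ, norm_mul, mul_comm]
  gcongr

/-- Finite products of terms of a null sequence are uniformly bounded. -/
theorem exists_norm_prod_le_of_tendsto_zero {a : ℕ → ℂ} (ha : Tendsto a atTop (𝓝 0)) :
    ∃ C : ℝ, 0 ≤ C ∧ ∀ s : Finset ℕ, ‖∏ j ∈ s, a j‖ ≤ C := by
  have h0 : Tendsto (fun n => ‖a n‖) atTop (𝓝 0) := by simpa using ha.norm
  obtain ⟨J, hJ⟩ := eventually_atTop.1 (h0.eventually_le_const one_pos)
  refine ⟨∏ j ∈ range J, max 1 ‖a j‖, prod_nonneg fun _ _ => by positivity, fun s => ?_⟩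
  calc ‖∏ j ∈ s, a j‖ = ∏ j ∈ s, ‖a j‖ := norm_prod _ _
    _ ≤ ∏ j ∈ s, max 1 ‖a j‖ := prod_le_prod (fun _ _ => norm_nonneg _) fun _ _ => le_max_right _ _
    _ ≤ ∏ j ∈ s ∪ range J, max 1 ‖a j‖ :=
      prod_le_prod_of_subset_of_one_le subset_union_left (fun _ _ => by positivity)
        fun _ _ _ => le_max_left _ _
    _ = ∏ j ∈ range J, max 1 ‖a j‖ := by
      refine (prod_subset subset_union_right fun j _ hj => ?_).symm
      exact max_eq_left (hJ j (by simpa using hj))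

/-! ### The Lambert series weighted by Pochhammer symbols -/

/-- The sum `f(z) = ∑_{n ≥ 1} Q^n / (1 - Q^n) * (z Q^n; Q)_∞`. -/
noncomputable def lambertPoch (z Q : ℂ) : ℂ :=
  ∑' n : ℕ, Q ^ (n + 1) / (1 - Q ^ (n + 1)) * qPochInf (z * Q ^ (n + 1)) Q

theorem summable_norm_lambert {Q : ℂ} (hQ : ‖Q‖ < 1) :
    Summable fun n : ℕ => ‖Q ^ (n + 1) / (1 - Q ^ (n + 1))‖ :=
  summable_div_one_sub (summable_norm_pow_comp hQ (add_left_injective 1))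

theorem summable_lambertPoch (z : ℂ) {Q : ℂ} (hQ : ‖Q‖ < 1) :
    Summable fun n : ℕ => Q ^ (n + 1) / (1 - Q ^ (n + 1)) * qPochInf (z * Q ^ (n + 1)) Q := by
  refine Summable.of_norm_bounded
    ((summable_norm_lambert hQ).mul_right (Real.exp (‖z‖ * (1 - ‖Q‖)⁻¹))) fun n => ?_
  rw [norm_mul]
  gcongr
  exact norm_qPochInf_mul_pow_le z hQ _

theorem one_sub_pow_succ_ne_zero {Q : ℂ} (hQ : ‖Q‖ < 1) (n : ℕ) : 1 - Q ^ (n + 1) ≠ 0 := by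
  intro h
  have h1 : ‖Q ^ (n + 1)‖ < 1 := by
    rw [norm_pow]
    exact pow_lt_one₀ (norm_nonneg _) hQ n.succ_ne_zero
  rw [← sub_eq_zero.1 h, norm_one] at h1
  exact lt_irrefl _ h1

/-- The `Q`-difference equation of `lambertPoch`. Termwise, `f(z) - (1 - z) f(z Q)` is
`(z Q^{n+1}; Q)_∞ - (z Q^n; Q)_∞`, which telescopes. -/
theorem lambertPoch_eq (z : ℂ) {Q : ℂ} (hQ : ‖Q‖ < 1) :
    lambertPoch z Q = (1 - z) * lambertPoch (z * Q) Q + 1 - qPochInf (z * Q) Q := by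
  have h1 := (summable_lambertPoch z hQ).hasSum
  have h2 := ((summable_lambertPoch (z * Q) hQ).hasSum).mul_left (1 - z)
  have h3 := (h1.sub h2).tendsto_sum_nat
  have key : ∀ n : ℕ, Q ^ (n + 1) / (1 - Q ^ (n + 1)) * qPochInf (z * Q ^ (n + 1)) Q -
      (1 - z) * (Q ^ (n + 1) / (1 - Q ^ (n + 1)) * qPochInf (z * Q * Q ^ (n + 1)) Q) =
      qPochInf (z * Q ^ (n + 1 + 1)) Q - qPochInf (z * Q ^ (n + 1)) Q := by
    intro n
    have e : z * Q * Q ^ (n + 1) = z * Q ^ (n + 1 + 1) := by ring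
    have e' : z * Q ^ (n + 1) * Q = z * Q ^ (n + 1 + 1) := by ring
    rw [e, qPochInf_eq_one_sub_mul (z * Q ^ (n + 1)) hQ, e']
    have := one_sub_pow_succ_ne_zero hQ n
    field_simp
    ring
  simp only [key] at h3
  simp only [sum_range_sub (fun n => qPochInf (z * Q ^ (n + 1)) Q)] at h3
  have h4 := tendsto_nhds_unique h3
    (((tendsto_add_atTop_iff_nat 1).2 (tendsto_qPochInf_mul_pow z hQ)).sub_const _)
  simp only [zero_add, pow_one] at h4
  unfold lambertPoch
  linear_combination h4

/-! ### Iterating the difference equation towards infinity -/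

section Iterate

variable {t Q : ℂ} {a : ℕ → ℂ}

/-- `∏_{j < m} a j` is `(t; Q)_{-m} = (t; Q)_∞ / (t Q^{-m}; Q)_∞`. -/
theorem prod_mul_qPochInf_div_pow (hQ : ‖Q‖ < 1) (hQ0 : Q ≠ 0)
    (ha : ∀ j, a j * (1 - t / Q ^ (j + 1)) = 1) (m : ℕ) :
    (∏ j ∈ range m, a j) * qPochInf (t / Q ^ m) Q = qPochInf t Q := by
  induction m with
  | zero => simp
  | succ m ih =>
    have e : t / Q ^ (m + 1) * Q = t / Q ^ m := by
      rw [pow_succ]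
      field_simp
    rw [prod_range_succ, qPochInf_eq_one_sub_mul (t / Q ^ (m + 1)) hQ, e, ← ih]
    linear_combination (∏ j ∈ range m, a j) * qPochInf (t / Q ^ m) Q * ha m

theorem lambertPoch_eq_iterate (hQ : ‖Q‖ < 1) (hQ0 : Q ≠ 0)
    (ha : ∀ j, a j * (1 - t / Q ^ (j + 1)) = 1) (m : ℕ) :
    lambertPoch t Q = (∏ j ∈ range m, a j) * lambertPoch (t / Q ^ m) Q
      + qPochInf t Q * ∑ n ∈ range m, a n - ∑ n ∈ range m, ∏ j ∈ range (n + 1), a j := by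
  induction m with
  | zero => simp
  | succ m ih =>
    have e : t / Q ^ (m + 1) * Q = t / Q ^ m := by
      rw [pow_succ]
      field_simp
    have hf := lambertPoch_eq (t / Q ^ (m + 1)) hQ
    rw [e] at hf
    have hp := prod_mul_qPochInf_div_pow hQ hQ0 ha m
    rw [ih, hf, sum_range_succ, sum_range_succ, prod_range_succ]
    linear_combination (-(∏ j ∈ range m, a j) * lambertPoch (t / Q ^ m) Q) * ha m + a m * hp

/-- The remainder of the iteration vanishes: the `n`-th term of
`(t; Q)_{-m} f(t Q^{-m})` carries the factor `(t; Q)_∞ / (t Q^{-m}; Q)_n`, which is bounded in `m`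
and `n`, and tends to `0` for each fixed `n ≥ 1`. -/
theorem tendsto_prod_mul_lambertPoch (hQ : ‖Q‖ < 1) (hQ0 : Q ≠ 0)
    (ha : ∀ j, a j * (1 - t / Q ^ (j + 1)) = 1) (ha0 : Tendsto a atTop (𝓝 0)) :
    Tendsto (fun m => (∏ j ∈ range m, a j) * lambertPoch (t / Q ^ m) Q) atTop (𝓝 0) := by
  obtain ⟨C, hC0, hC⟩ := exists_norm_prod_le_of_tendsto_zero ha0
  set B : ℝ := Real.exp (‖t‖ * (1 - ‖Q‖)⁻¹) with hB
  have hB0 : 0 ≤ B := (Real.exp_pos _).le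
  have hP : ‖qPochInf t Q‖ ≤ B := norm_qPochInf_le t hQ
  have hshort : ∀ m n, (∏ j ∈ range (m + n), a j) * qPochInf (t / Q ^ (m + n) * Q ^ n) Q =
      qPochInf t Q * ∏ j ∈ Ico m (m + n), a j := by
    intro m n
    have e : t / Q ^ (m + n) * Q ^ n = t / Q ^ m := by
      rw [pow_add]
      field_simp
    rw [e, ← prod_range_mul_prod_Ico a (Nat.le_add_right m n),
      ← prod_mul_qPochInf_div_pow hQ hQ0 ha m]
    ring
  have hbound : ∀ m n, ‖(∏ j ∈ range m, a j) * qPochInf (t / Q ^ m * Q ^ n) Q‖ ≤ C * B := by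
    intro m n
    rcases le_total n m with h | h
    · obtain ⟨k, rfl⟩ := Nat.exists_eq_add_of_le' h
      rw [hshort, norm_mul, mul_comm C]
      exact mul_le_mul hP (hC _) (norm_nonneg _) hB0
    · obtain ⟨k, rfl⟩ := Nat.exists_eq_add_of_le h
      have e : t / Q ^ m * Q ^ (m + k) = t * Q ^ k := by
        rw [pow_add]
        field_simp
      rw [e, norm_mul]
      exact mul_le_mul (hC _) (norm_qPochInf_mul_pow_le t hQ k) (norm_nonneg _) hC0
  have hlim : ∀ n, Tendsto
      (fun m => (∏ j ∈ range m, a j) * qPochInf (t / Q ^ m * Q ^ (n + 1)) Q) atTop (𝓝 0) := by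
    intro n
    rw [← tendsto_add_atTop_iff_nat (n + 1)]
    refine squeeze_zero_norm (a := fun m => B * (C * ‖a (m + n)‖)) (fun m => ?_) ?_
    · rw [hshort, norm_mul, ← add_assoc, prod_Ico_succ_top (Nat.le_add_right m n), norm_mul]
      gcongr
      exact hC _
    · have h0 : Tendsto (fun m => ‖a (m + n)‖) atTop (𝓝 0) := by
        simpa using ((tendsto_add_atTop_iff_nat n).2 ha0).norm
      simpa using (h0.const_mul C).const_mul B
  have h := tendsto_tsum_of_dominated_convergence (𝓕 := atTop)
    (f := fun m n => Q ^ (n + 1) / (1 - Q ^ (n + 1)) *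
      ((∏ j ∈ range m, a j) * qPochInf (t / Q ^ m * Q ^ (n + 1)) Q)) (g := fun _ : ℕ => (0 : ℂ))
    ((summable_norm_lambert hQ).mul_right (C * B))
    (fun n => by simpa using (hlim n).const_mul (Q ^ (n + 1) / (1 - Q ^ (n + 1))))
    (Eventually.of_forall fun m n => by
      rw [norm_mul]
      exact mul_le_mul_of_nonneg_left (hbound m (n + 1)) (norm_nonneg _))
  rw [tsum_zero] at h
  refine h.congr fun m => ?_
  rw [lambertPoch, ← tsum_mul_left]
  exact tsum_congr fun n => by ring

/-- With `a_j = 1 / (1 - t Q^{-j-1})`, whose partial products are `(t; Q)_{-n}`, this reads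
`f(t) = (t; Q)_∞ ∑_{n ≥ 1} 1 / (1 - t Q^{-n}) - ∑_{n ≥ 1} (t; Q)_{-n}`. -/
theorem lambertPoch_eq_tsum (hQ : ‖Q‖ < 1) (hQ0 : Q ≠ 0)
    (ha : ∀ j, a j * (1 - t / Q ^ (j + 1)) = 1) (hs : Summable a) :
    lambertPoch t Q = qPochInf t Q * ∑' n, a n - ∑' n, ∏ j ∈ range (n + 1), a j := by
  have ha0 := hs.tendsto_atTop_zero
  have hA := (summable_nat_add_iff 1).2 (summable_prod_range_of_tendsto_zero ha0)
  have h := ((tendsto_prod_mul_lambertPoch hQ hQ0 ha ha0).add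
    (hs.hasSum.tendsto_sum_nat.const_mul (qPochInf t Q))).sub hA.hasSum.tendsto_sum_nat
  rw [zero_add] at h
  exact tendsto_nhds_unique
    (tendsto_const_nhds.congr fun m => lambertPoch_eq_iterate hQ hQ0 ha m) h

end Iterate

/-! ### The specializations `(t, Q) = (-1, q)` and `(t, Q) = (-q, q²)` -/

theorem one_add_pow_succ_ne_zero {q : ℂ} (hq : ‖q‖ < 1) (n : ℕ) : 1 + q ^ (n + 1) ≠ 0 := by
  intro h
  have h1 : ‖q ^ (n + 1)‖ < 1 := by
    rw [norm_pow]
    exact pow_lt_one₀ (norm_nonneg _) hq n.succ_ne_zero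
  rw [← neg_eq_of_add_eq_zero_right h, norm_neg, norm_one] at h1
  exact lt_irrefl _ h1

theorem prod_pow_div_one_add (q : ℂ) (n : ℕ) :
    ∏ j ∈ range n, q ^ (j + 1) / (1 + q ^ (j + 1)) =
      q ^ (n * (n + 1) / 2) / qPoch (-q) q n := by
  rw [prod_div_distrib, prod_pow_eq_pow_sum, qPoch]
  congr 1
  · have h := sum_range_succ' (fun i => i) n
    rw [add_zero] at h
    rw [← h, sum_range_id, Nat.add_sub_cancel, mul_comm]
  · exact prod_congr rfl fun j _ => by ring

theorem prod_odd_pow_div_one_add (q : ℂ) (n : ℕ) :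
    ∏ j ∈ range n, q ^ (2 * j + 1) / (1 + q ^ (2 * j + 1)) =
      q ^ (n ^ 2) / qPoch (-q) (q ^ 2) n := by
  rw [prod_div_distrib, prod_pow_eq_pow_sum, qPoch]
  congr 1
  · congr 1
    induction n with
    | zero => simp
    | succ n ih =>
      rw [sum_range_succ, ih]
      ring
  · exact prod_congr rfl fun j _ => by ring

/-- Sums over `n ≥ 1` are indexed by `n : ℕ` with `n + 1` in place of `n`. -/
theorem theorem1p5 (q : ℂ) (hq : ‖q‖ < 1) :
    -- all the series converge (absolutely)
    (Summable (fun n : ℕ => q ^ (n + 1) / (1 - q ^ (n + 1)) * qPochInf (-q ^ ((n + 1) + 1)) q) ∧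
      Summable (fun n : ℕ => q ^ (n + 1) / (1 + q ^ (n + 1))) ∧
      Summable (fun n : ℕ => q ^ (n * (n + 1) / 2) / qPoch (-q) q n) ∧
      -- part (i)
      ∑' n : ℕ, q ^ (n + 1) / (1 - q ^ (n + 1)) * qPochInf (-q ^ ((n + 1) + 1)) q =
        qPochInf (-q) q * (1 / 2 + ∑' n : ℕ, q ^ (n + 1) / (1 + q ^ (n + 1))) -
          1 / 2 * ∑' n : ℕ, q ^ (n * (n + 1) / 2) / qPoch (-q) q n) ∧
    (Summable (fun n : ℕ => q ^ (2 * (n + 1)) / (1 - q ^ (2 * (n + 1))) *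
        qPochInf (-q ^ (2 * (n + 1) + 1)) (q ^ 2)) ∧
      Summable (fun n : ℕ => q ^ (2 * (n + 1) - 1) / (1 + q ^ (2 * (n + 1) - 1))) ∧
      Summable (fun n : ℕ => q ^ ((n + 1) ^ 2) / qPoch (-q) (q ^ 2) (n + 1)) ∧
      -- part (ii)
      ∑' n : ℕ, q ^ (2 * (n + 1)) / (1 - q ^ (2 * (n + 1))) *
          qPochInf (-q ^ (2 * (n + 1) + 1)) (q ^ 2) =
        qPochInf (-q) (q ^ 2) * ∑' n : ℕ, q ^ (2 * (n + 1) - 1) / (1 + q ^ (2 * (n + 1) - 1)) -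
          ∑' n : ℕ, q ^ ((n + 1) ^ 2) / qPoch (-q) (q ^ 2) (n + 1)) := by
  have hq2 : ‖q ^ 2‖ < 1 := by
    rw [norm_pow]
    exact pow_lt_one₀ (norm_nonneg _) hq two_ne_zero
  have hodd : ∀ n : ℕ, 2 * (n + 1) - 1 = 2 * n + 1 := fun n => by lia
  have s1 : Summable fun n : ℕ => q ^ (n + 1) / (1 + q ^ (n + 1)) :=
    summable_pow_div_one_add hq (add_left_injective 1)
  have s2 : Summable fun n : ℕ => q ^ (2 * n + 1) / (1 + q ^ (2 * n + 1)) :=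
    summable_pow_div_one_add hq (e := fun n => 2 * n + 1) fun m n h => by
      simp only at h
      lia
  have p1 := summable_prod_range_of_tendsto_zero s1.tendsto_atTop_zero
  have p2 := summable_prod_range_of_tendsto_zero s2.tendsto_atTop_zero
  have f1 : ∀ n : ℕ, -q ^ (n + 1 + 1) = -q * q ^ (n + 1) := fun n => by ring
  have f2 : ∀ n : ℕ, -q ^ (2 * (n + 1) + 1) = -q * (q ^ 2) ^ (n + 1) := fun n => by ring
  have f3 : ∀ n : ℕ, q ^ (2 * (n + 1)) = (q ^ 2) ^ (n + 1) := fun n => pow_mul q 2 (n + 1)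
  simp only [hodd, f1, f2, ← prod_pow_div_one_add, ← prod_odd_pow_div_one_add, f3]
  refine ⟨⟨summable_lambertPoch (-q) hq, s1, p1, ?_⟩, summable_lambertPoch (-q) hq2, s2,
    p2.comp_injective (add_left_injective 1), ?_⟩
  · change lambertPoch (-q) q = _
    rw [p1.tsum_eq_zero_add]
    rcases eq_or_ne q 0 with rfl | hq0
    · simp [lambertPoch, qPochInf]
    have h := lambertPoch_eq_tsum (t := -1) hq hq0 (fun j => ?_) s1
    · -- `f(-1) = 2 f(-q) + 1 - (-q; q)_∞` and `(-1; q)_∞ = 2 (-q; q)_∞`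
      have h1 := lambertPoch_eq (-1) hq
      have h2 := qPochInf_eq_one_sub_mul (-1) hq
      rw [neg_one_mul] at h1 h2
      rw [h1, h2] at h
      rw [prod_range_zero]
      linear_combination h / 2
    · have := one_add_pow_succ_ne_zero hq j
      field_simp
      ring
  · change lambertPoch (-q) (q ^ 2) = _
    rcases eq_or_ne q 0 with rfl | hq0
    · simp [lambertPoch]
    refine lambertPoch_eq_tsum hq2 (pow_ne_zero 2 hq0) (fun j => ?_) s2
    have := one_add_pow_succ_ne_zero hq (2 * j)
    rw [← pow_mul]
    field_simp
    ring
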